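/- All graphs are simple and locally finite, and may have infinitely many vertices. A $d$-regular graph $G$ that is neither complete nor edgeless is called amply regular with parameters $(d,\alpha,\beta)$ if any two adjacent vertices have exactly $\alpha$ common neighbors and any two vertices at distance two have exactly $\beta$ common neighbors. A graph with at least two vertices is $l$-edge-connected if deleting any set of fewer than $l$ edges leaves a connected graph. Theorem. Let $G=(V,E)$ be a connected amply regular graph with parameters $(d,\alpha,\beta)$, where $\beta>1$. Then $G$ is $d$-edge-connected. Further, if $G$ is not a quadrangle (a cycle of length $4$), then for every set $F\subseteq E$ of exactly $d$ edges, the graph $G-F$ is disconnected if and only if $F$ is the set of the $d$ edges incident to some single vertex of $G$. -/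

import Mathlib

namespace SimpleGraph

/-- `G` is amply regular with parameters `(d, α, β)`: it is `d`-regular, neither complete nor empty
(i.e. edgeless), any two adjacent vertices have exactly `α` common neighbours, and any two vertices
at distance two have exactly `β` common neighbours. The vertex set may be infinite; the sets of
common neighbours are finite, because `G` is locally finite. -/
structure IsAmplyRegularWith {V : Type*} (G : SimpleGraph V) [G.LocallyFinite]
    (d α β : ℕ) : Prop where
  regular : G.IsRegularOfDegree d
  not_complete : G ≠ ⊤
  not_empty : G ≠ ⊥
  of_adj : ∀ x y : V, G.Adj x y → (G.commonNeighbors x y).ncard = α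
  of_dist_eq_two : ∀ x y : V, G.dist x y = 2 → (G.commonNeighbors x y).ncard = β

end SimpleGraph

/-!
Let `S` be a side of an edge cut, and for `y ∉ S` let `b y` be the number of neighbours of `y`
in `S`, so that the cut has `∑ b` edges, summed over the outer boundary of `S`. The whole theorem
rests on one double count around a single cut edge `st`, with `s ∈ S` and `t ∉ S`.

Call `w ∉ S` *interior* if it has no neighbour in `S`. An interior neighbour `w` of `t` is at
distance two from `s`, so exactly `β` of the neighbours `y ∉ S` of `s` are adjacent to `w`, and one
of these is `t`. Writing `m y` for the number of interior neighbours of `t` adjacent to `y`, this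
says that `β - 1` times the number of interior neighbours of `t` is `∑ m y`, over the neighbours
`y ∉ S` of `s` other than `t`. For such `y` let `k y ≥ 1` be the number of common neighbours of `y`
and `t` in `S`.

* If `y` is adjacent to `t`, comparing the `α` common neighbours of `t, y` with the `α` common
  neighbours of `s, y` gives `m y + k y ≤ b y + f y`, where `f y` counts the neighbours of `y` among
  the `z ∉ S` that are adjacent to `s` but neither equal nor adjacent to `t`.
* If `y` is not adjacent to `t`, the `β` common neighbours of `t` and `y` give
  `k y + c y + m y ≤ β`, where `c y` counts those that are adjacent to `s` and outside `S`.

Since `∑ f = ∑ c`, summing up bounds the number of interior neighbours of `t`. As `t` has degree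
`d`, this forces `∑ b ≥ d`: every cut has at least `d` edges. When `∑ b = d`, all the estimates are
equalities, which is what `IsAmplyRegularWith.sum_eq_and_of_cut_edge` records.

These equalities say that at most one `z` in the boundary has `b z ≥ 2`, and that such a `z` is
adjacent to the whole boundary on both sides (`IsAmplyRegularWith.boundary_of_two_le`). The same
holds with the two sides exchanged. If both sides have such a vertex, these two vertices have
`d - 1` common neighbours, so that `G` would be complete
(`IsAmplyRegularWith.add_one_lt_degree`). If exactly one side has such a vertex, that side is a
single vertex (`IsAmplyRegularWith.eq_singleton_of_two_le`). If neither has one, the cut is a perfect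
matching between two cliques that exhaust `G` (`IsAmplyRegularWith.adj_of_matching_cut`); then
`α = 0`, the cliques have at most two vertices, and `G` is a quadrangle or a side is a single vertex.
-/

namespace SimpleGraph

/-! ### Connected graphs and the quadrangle -/

variable {V : Type*} {G : SimpleGraph V}

theorem Connected.mem_of_adj_closed (hconn : G.Connected) {P : Set V} {u : V} (hu : u ∈ P)
    (hP : ∀ x ∈ P, ∀ y, G.Adj x y → y ∈ P) (v : V) : v ∈ P := by
  obtain ⟨p⟩ := hconn.preconnected u v
  induction p with
  | nil => exact hu
  | cons h _ ih => exact ih (hP _ hu _ h)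

theorem Adj.dist_eq_two {x y z : V} (hxz : G.Adj x z) (hzy : G.Adj z y) (hne : x ≠ y)
    (hxy : ¬ G.Adj x y) : G.dist x y = 2 := by
  have h1 : G.dist x y ≤ 2 := dist_le (Walk.cons hxz (Walk.cons hzy Walk.nil))
  have h2 := (hxz.reachable.trans hzy.reachable).one_lt_dist_of_ne_of_not_adj hne hxy
  omega

/-- When `G - F` separates `u` from `v`, the vertices that `G - F` links to `u` form one side of a
cut of `G` all of whose edges lie in `F`. -/
theorem Connected.exists_cut (hconn : G.Connected) {F : Set (Sym2 V)} {u v : V}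
    (h : ¬ (G.deleteEdges F).Reachable u v) :
    ∃ S : Set V, (∀ x ∈ S, ∀ y, y ∉ S → G.Adj x y → s(x, y) ∈ F) ∧
      ∃ s ∈ S, ∃ t, t ∉ S ∧ G.Adj s t := by
  refine ⟨{w | (G.deleteEdges F).Reachable u w}, ?_, ?_⟩
  · intro x hx y hy hxy
    by_contra hF
    exact hy (Reachable.trans hx (Adj.reachable (deleteEdges_adj.2 ⟨hxy, hF⟩)))
  · by_contra! hcl
    exact h (hconn.mem_of_adj_closed (P := {w | (G.deleteEdges F).Reachable u w}) (u := u)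
      (Reachable.refl u) (fun x hx y hxy => by_contra fun hy => hcl x hx y hy hxy) v)

/-- Four vertices in cyclic order that make up the whole graph. -/
theorem nonempty_iso_cycleGraph_four {a b c e : V} (hab : G.Adj a b) (hbc : G.Adj b c)
    (hce : G.Adj c e) (hea : G.Adj e a) (hac : ¬ G.Adj a c) (hbe : ¬ G.Adj b e)
    (hac' : a ≠ c) (hbe' : b ≠ e) (hall : ∀ v, v = a ∨ v = b ∨ v = c ∨ v = e) :
    Nonempty (G ≃g cycleGraph 4) := by
  refine ⟨(RelIso.symm ⟨Equiv.ofBijective ![a, b, c, e] ⟨?_, ?_⟩, ?_⟩)⟩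
  · intro i j h
    fin_cases i <;> fin_cases j <;>
      simp_all [hab.ne, hab.ne', hbc.ne, hbc.ne', hce.ne, hce.ne', hea.ne, hea.ne', hac'.symm,
        hbe'.symm]
  · intro v
    rcases hall v with rfl | rfl | rfl | rfl
    exacts [⟨0, rfl⟩, ⟨1, rfl⟩, ⟨2, rfl⟩, ⟨3, rfl⟩]
  · intro i j
    change G.Adj (![a, b, c, e] i) (![a, b, c, e] j) ↔ _
    fin_cases i <;> fin_cases j <;>
      simp [cycleGraph_adj, hab, hab.symm, hbc, hbc.symm, hce, hce.symm, hea, hea.symm, hac, hbe,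
        G.adj_comm c a, G.adj_comm e b] <;> decide

/-! ### Edge cuts and their vertex boundaries -/

variable [G.LocallyFinite] {d α β : ℕ} {S : Set V} {D D' : Finset V}

open Classical in
variable (G) in
/-- The finite set of neighbours of `v` that lie in `S`. -/
noncomputable def neighborsIn (S : Set V) (v : V) : Finset V := {x ∈ G.neighborFinset v | x ∈ S}

@[simp]
theorem mem_neighborsIn {v x : V} : x ∈ G.neighborsIn S v ↔ G.Adj v x ∧ x ∈ S := by
  simp [neighborsIn]

variable (G) in
/-- `D` is the outer vertex boundary of `S`: the vertices outside `S` with a neighbour in `S`. -/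
def IsOuterBoundary (S : Set V) (D : Finset V) : Prop :=
  ∀ y, y ∈ D ↔ y ∉ S ∧ ∃ x ∈ S, G.Adj x y

theorem IsOuterBoundary.card_neighborsIn_pos (hD : G.IsOuterBoundary S D) {y : V} (hy : y ∈ D) :
    1 ≤ (G.neighborsIn S y).card := by
  obtain ⟨x, hx, hxy⟩ := ((hD y).1 hy).2
  exact Finset.card_pos.2 ⟨x, by simp [hx, hxy.symm]⟩

open Classical in
theorem ncard_commonNeighbors (x y : V) :
    (G.commonNeighbors x y).ncard = (G.neighborFinset y |>.filter (G.Adj x)).card := by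
  rw [← Set.ncard_coe_finset]
  congr 1
  ext z
  simp [mem_commonNeighbors, and_comm]

/-- A cut contained in a finite edge set `F` has a finite outer boundary, and at most `|F|` edges,
counted through their endpoints in the boundary. -/
theorem exists_isOuterBoundary {F : Set (Sym2 V)} (hF : F.Finite)
    (hS : ∀ x ∈ S, ∀ y, y ∉ S → G.Adj x y → s(x, y) ∈ F) :
    ∃ D, G.IsOuterBoundary S D ∧ ∑ y ∈ D, (G.neighborsIn S y).card ≤ F.ncard := by
  classical
  have hfin : {y | y ∉ S ∧ ∃ x ∈ S, G.Adj x y}.Finite := by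
    refine (hF.biUnion (t := fun e => {v | v ∈ e}) fun e _ => ?_).subset ?_
    · induction e with
      | _ a b => exact (Set.toFinite {a, b}).subset fun v hv => by simpa using hv
    · rintro y ⟨hy, x, hx, hxy⟩
      simp only [Set.mem_iUnion]
      exact ⟨_, hS x hx y hy hxy, by simp⟩
  refine ⟨hfin.toFinset, fun y => by simp, ?_⟩
  rw [← Finset.card_sigma, Set.ncard_eq_toFinset_card F hF]
  refine Finset.card_le_card_of_injOn (fun p => s(p.2, p.1)) ?_ ?_
  · rintro ⟨y, x⟩ h
    simp only [Finset.coe_sigma, Set.mem_sigma_iff, Finset.mem_coe, Set.Finite.mem_toFinset,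
      mem_neighborsIn, Set.mem_ofPred_eq] at h ⊢
    exact hS x h.2.2 y h.1.1 h.2.1.symm
  · rintro ⟨y, x⟩ h ⟨y', x'⟩ h' heq
    simp only [Finset.coe_sigma, Set.mem_sigma_iff, Finset.mem_coe, Set.Finite.mem_toFinset,
      mem_neighborsIn, Set.mem_ofPred_eq, Sym2.eq_iff] at h h' heq
    rcases heq with ⟨rfl, rfl⟩ | ⟨rfl, rfl⟩
    · rfl
    · exact absurd h.2.2 h'.1.1

/-! ### Double counting around a cut edge -/

open Classical in
/-- A cut of at most `d` edges has exactly `d`, and then every estimate of the double count around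
a cut edge `st` is sharp. For a boundary vertex `y ≠ t` this means: if `y` is adjacent to both `s`
and `t`, then `s` is the only common neighbour of `y` and `t` in `S`; otherwise `y` is on a single
cut edge, and it is adjacent to at least one of `s` and `t`. -/
theorem IsAmplyRegularWith.sum_eq_and_of_cut_edge (hG : G.IsAmplyRegularWith d α β) (hβ : 1 < β)
    (hD : G.IsOuterBoundary S D) (hsum : ∑ y ∈ D, (G.neighborsIn S y).card ≤ d)
    {s t : V} (hs : s ∈ S) (ht : t ∉ S) (hst : G.Adj s t) :
    ∑ y ∈ D, (G.neighborsIn S y).card = d ∧ ∀ y ∈ D, y ≠ t →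
      (G.Adj s y → G.Adj t y → ∀ x ∈ S, G.Adj t x → G.Adj y x → x = s) ∧
      (¬ (G.Adj s y ∧ G.Adj t y) → (G.neighborsIn S y).card = 1) ∧
      (¬ G.Adj s y → G.Adj t y) := by
  -- The boundary `D` is the disjoint union of `{t}`, `A`, `B` and `O`; the neighbours of `s`
  -- outside `S` form `N = {t} ∪ A ∪ B`; and `I` consists of the interior neighbours of `t`.
  set N := G.neighborsIn Sᶜ s with hN
  set A := N.filter (fun y => G.Adj t y) with hA
  set B := N.filter (fun y => y ≠ t ∧ ¬ G.Adj t y) with hB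
  set O := D.filter (fun y => ¬ G.Adj s y) with hO
  set I := (G.neighborFinset t).filter (fun w => w ∉ S ∧ w ∉ D) with hI
  set b : V → ℕ := fun y => (G.neighborsIn S y).card with hb
  set k : V → ℕ := fun y => ((G.neighborsIn S y).filter (fun x => G.Adj t x)).card with hk
  set m : V → ℕ := fun y => (I.filter (fun w => G.Adj y w)).card with hm
  set c : V → ℕ := fun y => (A.filter (fun x => G.Adj y x)).card with hc
  set f : V → ℕ := fun y => (B.filter (fun x => G.Adj y x)).card with hf
  have hAN : ∀ y ∈ A, G.Adj s y ∧ y ∉ S ∧ G.Adj t y := by simp [hA, hN]; tauto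
  have hBN : ∀ y ∈ B, G.Adj s y ∧ y ∉ S ∧ y ≠ t ∧ ¬ G.Adj t y := by simp [hB, hN]; tauto
  have hIm : ∀ w ∈ I, G.Adj t w ∧ w ∉ S ∧ ∀ x ∈ S, ¬ G.Adj x w := by
    intro w hw
    simp only [hI, Finset.mem_filter, mem_neighborFinset, hD w] at hw
    exact ⟨hw.1, hw.2.1, fun x hx hxw => hw.2.2 ⟨hw.2.1, x, hx, hxw⟩⟩
  have splitN : ∀ g : V → ℕ, ∑ y ∈ N, g y = g t + ∑ y ∈ A, g y + ∑ y ∈ B, g y := by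
    intro g
    have htN : t ∈ N := by simp [hN, hst, ht]
    have hA' : A = (N.erase t).filter (fun y => G.Adj t y) := by
      ext y
      simp only [hA, Finset.mem_filter, Finset.mem_erase]
      exact ⟨fun h => ⟨⟨h.2.ne', h.1⟩, h.2⟩, fun h => ⟨h.1.2, h.2⟩⟩
    have hB' : B = (N.erase t).filter (fun y => ¬ G.Adj t y) := by
      ext y
      simp only [hB, Finset.mem_filter, Finset.mem_erase]
      tauto
    rw [← Finset.add_sum_erase _ _ htN,
      ← Finset.sum_filter_add_sum_filter_not (N.erase t) (fun y => G.Adj t y), hA', hB', add_assoc]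
  have hND : N = D.filter (fun y => G.Adj s y) := by
    ext y
    simp only [hN, mem_neighborsIn, Set.mem_compl_iff, Finset.mem_filter, hD y]
    exact ⟨fun h => ⟨⟨h.2, s, hs, h.1⟩, h.1⟩, fun h => ⟨h.2, h.1.1⟩⟩
  have splitD : ∀ g : V → ℕ,
      ∑ y ∈ D, g y = g t + ∑ y ∈ A, g y + ∑ y ∈ B, g y + ∑ y ∈ O, g y := by
    intro g
    rw [← splitN, hND, hO, Finset.sum_filter_add_sum_filter_not]
  -- The neighbours of `t` lie in `S`, in the boundary, or in `I`.
  have hdeg : d = b t + (A.card + (O.filter (fun y => G.Adj t y)).card) + I.card := by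
    have h1 := splitD (fun y => if G.Adj t y then 1 else 0)
    have h2 : ∑ y ∈ A, (if G.Adj t y then 1 else 0) = A.card := by
      rw [Finset.card_eq_sum_ones]
      exact Finset.sum_congr rfl fun y hy => if_pos (hAN y hy).2.2
    have h3 : ∑ y ∈ B, (if G.Adj t y then 1 else 0) = 0 :=
      Finset.sum_eq_zero fun y hy => if_neg (hBN y hy).2.2.2
    rw [h2, h3, ← Finset.card_filter, ← Finset.card_filter] at h1
    simp only [G.irrefl, if_false, zero_add, add_zero] at h1
    rw [← h1, ← hG.regular t, ← card_neighborFinset_eq_degree,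
      ← Finset.card_filter_add_card_filter_not (s := G.neighborFinset t) (fun x => x ∈ S),
      ← Finset.card_filter_add_card_filter_not
        (s := (G.neighborFinset t).filter (fun x => ¬ x ∈ S)) (fun x => x ∈ D),
      Finset.filter_filter, Finset.filter_filter, ← add_assoc]
    congr 3
    ext y
    simp only [Finset.mem_filter, mem_neighborFinset]
    constructor
    · tauto
    · exact fun h => ⟨h.2, ((hD y).1 h.1).1, h.1⟩
  -- Count the pairs of adjacent `y ∈ N` and `w ∈ I`: all `β` common neighbours of `s` and `w` lie
  -- in `N`, because `w` has no neighbour in `S`.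
  have hcount : β * I.card = I.card + ∑ y ∈ A, m y + ∑ y ∈ B, m y := by
    have h1 : m t = I.card := by
      rw [hm]
      exact congrArg _ (Finset.filter_true_of_mem fun w hw => (hIm w hw).1)
    rw [← h1, ← splitN, h1]
    have h2 := Finset.sum_card_bipartiteAbove_eq_sum_card_bipartiteBelow (s := N) (t := I) G.Adj
    rw [show ∑ y ∈ N, m y = _ from h2, Finset.sum_const_nat (m := β), mul_comm]
    intro w hw
    obtain ⟨htw, hwS, hw'⟩ := hIm w hw
    have hd2 : G.dist s w = 2 := hst.dist_eq_two htw (fun h => hwS (h ▸ hs)) (hw' s hs)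
    rw [← hG.of_dist_eq_two s w hd2, ncard_commonNeighbors]
    congr 1
    ext y
    simp only [Finset.bipartiteBelow, hN, Finset.mem_filter, mem_neighborsIn, Set.mem_compl_iff,
      mem_neighborFinset, G.adj_comm w y]
    exact ⟨fun h => ⟨h.2, h.1.1⟩, fun h => ⟨⟨h.2, fun hy => hw' y hy h.1⟩, h.1⟩⟩
  have hkcm : ∀ y, k y + c y + m y ≤ (G.commonNeighbors t y).ncard := by
    intro y
    rw [ncard_commonNeighbors, hk, hc, hm]
    simp only
    rw [← Finset.card_union_of_disjoint, ← Finset.card_union_of_disjoint]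
    · refine Finset.card_le_card fun z hz => ?_
      simp only [Finset.mem_union, Finset.mem_filter, mem_neighborsIn] at hz
      simp only [Finset.mem_filter, mem_neighborFinset]
      rcases hz with (hz | hz) | hz
      · exact ⟨hz.1.1, hz.2⟩
      · exact ⟨hz.2, (hAN z hz.1).2.2⟩
      · exact ⟨hz.2, (hIm z hz.1).1⟩
    · refine Finset.disjoint_left.2 fun z hz hz' => ?_
      simp only [Finset.mem_union, Finset.mem_filter, mem_neighborsIn] at hz hz'
      rcases hz with hz | hz
      · exact (hIm z hz'.1).2.1 hz.1.2
      · exact (hIm z hz'.1).2.2 s hs (hAN z hz.1).1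
    · refine Finset.disjoint_left.2 fun z hz hz' => ?_
      simp only [Finset.mem_filter, mem_neighborsIn] at hz hz'
      exact (hAN z hz'.1).2.1 hz.1.2
  -- The `α` common neighbours of `s` and `y` number at most `(b y - 1) + (1 + c y + f y)`: those
  -- in `S` are neighbours of `y` other than `s`, the rest are `t` or lie in `A ∪ B`.
  have hAle : ∀ y ∈ A, m y + k y ≤ b y + f y := by
    intro y hy
    obtain ⟨hsy, hyS, hty⟩ := hAN y hy
    have h1 := hkcm y
    rw [hG.of_adj t y hty, ← hG.of_adj s y hsy, ncard_commonNeighbors] at h1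
    have h2 := splitN (fun x => if G.Adj y x then 1 else 0)
    rw [← Finset.card_filter, ← Finset.card_filter, ← Finset.card_filter, if_pos hty.symm] at h2
    have h3 : (G.neighborFinset y |>.filter (G.Adj s)) ⊆
        (G.neighborsIn S y).erase s ∪ N.filter (fun x => G.Adj y x) := by
      intro z hz
      simp only [Finset.mem_filter, mem_neighborFinset] at hz
      simp only [Finset.mem_union, Finset.mem_erase, mem_neighborsIn, Finset.mem_filter, hN,
        Set.mem_compl_iff]
      by_cases hzS : z ∈ S
      · exact Or.inl ⟨hz.2.ne', hz.1, hzS⟩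
      · exact Or.inr ⟨⟨hz.2, hzS⟩, hz.1⟩
    have h4 := (Finset.card_le_card h3).trans (Finset.card_union_le _ _)
    have hsmem : s ∈ G.neighborsIn S y := by simp [hs, hsy.symm]
    rw [Finset.card_erase_of_mem hsmem] at h4
    have h5 : 0 < (G.neighborsIn S y).card := Finset.card_pos.2 ⟨s, hsmem⟩
    simp only [hb, hf, hc] at *
    omega
  have hBle : ∀ y ∈ B, k y + c y + m y ≤ β := by
    intro y hy
    obtain ⟨hsy, hyS, hyt, hty⟩ := hBN y hy
    exact (hkcm y).trans (hG.of_dist_eq_two t y (hst.symm.dist_eq_two hsy hyt.symm hty)).le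
  have hfc : ∑ y ∈ A, f y = ∑ y ∈ B, c y := by
    have h2 := Finset.sum_card_bipartiteAbove_eq_sum_card_bipartiteBelow (s := A) (t := B) G.Adj
    refine h2.trans (Finset.sum_congr rfl fun y _ => ?_)
    simp only [Finset.bipartiteBelow, hc, G.adj_comm]
  have hk1 : ∀ y, G.Adj s y → 1 ≤ k y := fun y hsy =>
    Finset.card_pos.2 ⟨s, by simp [hs, hsy.symm, hst.symm]⟩
  have hkA : ∀ y ∈ A, 1 ≤ k y := fun y hy => hk1 y (hAN y hy).1
  have hkB : ∀ y ∈ B, 1 ≤ k y := fun y hy => hk1 y (hBN y hy).1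
  have hkb : ∀ y, k y ≤ b y := fun y => Finset.card_le_card (Finset.filter_subset _ _)
  have hbB : ∀ y ∈ B, 1 ≤ b y := fun y hy => (hkB y hy).trans (hkb y)
  have hOb : ∀ y ∈ O, (if G.Adj t y then 1 else 0) ≤ b y := by
    intro y hy
    have := hD.card_neighborsIn_pos (Finset.mem_filter.1 hy).1
    split_ifs
    · exact this
    · exact Nat.zero_le _
  -- The sums over `A` and `B` give `(β - 1) * #I + ∑ k ≤ ∑_A b + β * #B`, while `hdeg` and
  -- `hsum` give `#I = #B + W` with `W ≥ ∑_A (b - 1)`. As `β - 1 ≥ 1`, nothing is lost anywhere.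
  have e1 : ∑ y ∈ D, b y ≤ d := hsum
  have e2 := splitD b
  have e3 := Finset.sum_le_sum hAle
  have e4 := Finset.sum_le_sum hBle
  have e5 := Finset.sum_le_sum hkA
  have e6 := Finset.sum_le_sum hkB
  have e7 := Finset.sum_le_sum fun y (_ : y ∈ A) => hkb y
  have e8 := Finset.sum_le_sum hbB
  have e9 := Finset.sum_le_sum hOb
  simp only [Finset.sum_add_distrib, Finset.sum_const, smul_eq_mul, mul_one] at e3 e4 e5 e6 e8
  rw [← Finset.card_filter] at e9
  obtain ⟨W, hW⟩ : ∃ W, I.card = B.card + W := ⟨I.card - B.card, by omega⟩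
  obtain ⟨γ, rfl⟩ : ∃ γ, β = γ + 1 := ⟨β - 1, by omega⟩
  have hγW : W ≤ γ * W := Nat.le_mul_of_pos_left _ (by omega)
  have e10 : γ * I.card = γ * B.card + γ * W := by rw [hW, mul_add]
  rw [add_mul, one_mul] at hcount
  rw [mul_add, mul_one, mul_comm] at e4
  have r0 : ∑ y ∈ D, b y = d := by omega
  have r1 : ∑ y ∈ A, 1 = ∑ y ∈ A, k y := by
    rw [← Finset.card_eq_sum_ones]; omega
  have r2 : ∑ y ∈ B, 1 = ∑ y ∈ B, b y := by
    rw [← Finset.card_eq_sum_ones]; omega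
  have r3 : ∑ y ∈ O, (if G.Adj t y then 1 else 0) = ∑ y ∈ O, b y := by
    rw [← Finset.card_filter]; omega
  rw [Finset.sum_eq_sum_iff_of_le hkA] at r1
  rw [Finset.sum_eq_sum_iff_of_le hbB] at r2
  rw [Finset.sum_eq_sum_iff_of_le hOb] at r3
  refine ⟨r0, fun y hy hyt => ?_⟩
  have hyS := ((hD y).1 hy).1
  have hpos : 1 ≤ b y := hD.card_neighborsIn_pos hy
  by_cases hsy : G.Adj s y
  · by_cases hty : G.Adj t y
    · refine ⟨fun _ _ x hx htx hyx => ?_, by simp [hsy, hty], by simp [hsy]⟩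
      have h1 := r1 y (by simp [hA, hN, hsy, hty, hyS])
      exact Finset.card_le_one.1 h1.ge x (by simp [hx, htx, hyx]) s
        (by simp [hs, hst.symm, hsy.symm])
    · have h1 := r2 y (by simp [hB, hN, hsy, hty, hyS, hyt])
      exact ⟨fun _ h => absurd h hty, fun _ => h1.symm, fun h => absurd hsy h⟩
  · have h1 := r3 y (by simp [hO, hy, hsy])
    have hty : G.Adj t y := by
      by_contra hty
      rw [if_neg hty] at h1
      omega
    rw [if_pos hty] at h1
    exact ⟨fun h => absurd h hsy, fun _ => h1.symm, fun _ => hty⟩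

/-! ### Cuts with exactly `d` edges -/

/-- In a cut of at most `d` edges, a boundary vertex `z` on two cut edges is adjacent to all other
boundary vertices on both sides, and is the only one on its side that lies on two cut edges. -/
theorem IsAmplyRegularWith.boundary_of_two_le (hG : G.IsAmplyRegularWith d α β) (hβ : 1 < β)
    (hD : G.IsOuterBoundary S D) (hsum : ∑ y ∈ D, (G.neighborsIn S y).card ≤ d)
    {z : V} (hz : z ∈ D) (hz2 : 2 ≤ (G.neighborsIn S z).card) :
    (∀ y ∈ D, y ≠ z → G.Adj y z ∧ (G.neighborsIn S y).card = 1) ∧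
      ∀ x ∈ S, ∀ y, y ∉ S → G.Adj x y → G.Adj x z := by
  have key : ∀ x ∈ S, ∀ y, y ∉ S → G.Adj x y → y ≠ z → G.Adj x z ∧ G.Adj y z ∧
      ∀ x' ∈ S, G.Adj y x' → G.Adj z x' → x' = x := by
    intro x hx y hy hxy hyz
    obtain ⟨h1, h2, -⟩ := (hG.sum_eq_and_of_cut_edge hβ hD hsum hx hy hxy).2 z hz hyz.symm
    have h3 : G.Adj x z ∧ G.Adj y z := by
      by_contra h
      have := h2 h
      omega
    exact ⟨h3.1, h3.2, h1 h3.1 h3.2⟩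
  constructor
  · intro y hy hyz
    obtain ⟨hyS, x, hx, hxy⟩ := (hD y).1 hy
    obtain ⟨-, h2, h3⟩ := key x hx y hyS hxy hyz
    refine ⟨h2, Finset.card_eq_one.2 ⟨x, Finset.eq_singleton_iff_unique_mem.2
      ⟨by simp [hx, hxy.symm], fun x' hx' => ?_⟩⟩⟩
    rw [mem_neighborsIn] at hx'
    exact h3 x' hx'.2 hx'.1 (key x' hx'.2 y hyS hx'.1.symm hyz).1.symm
  · intro x hx y hy hxy
    by_cases hyz : y = z
    · exact hyz ▸ hxy
    · exact (key x hx y hy hxy hyz).1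

/-- If `α + 1 ≥ d`, then every neighbour of `y` other than `z` is a common neighbour of the adjacent
vertices `y` and `z`. Adjacency is then transitive, and the connected graph `G` is complete. -/
theorem IsAmplyRegularWith.add_one_lt_degree (hG : G.IsAmplyRegularWith d α β)
    (hconn : G.Connected) : α + 1 < d := by
  classical
  by_contra! hα
  apply hG.not_complete
  have htrans : ∀ x y z, G.Adj x y → G.Adj y z → x ≠ z → G.Adj x z := by
    intro x y z hxy hyz hxz
    have h1 : (G.neighborFinset y).filter (G.Adj z) ⊆ (G.neighborFinset y).erase z := by
      intro w hw
      simp only [Finset.mem_filter, Finset.mem_erase, mem_neighborFinset] at hw ⊢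
      exact ⟨hw.2.ne', hw.1⟩
    have h2 : (G.neighborFinset y).erase z ⊆ (G.neighborFinset y).filter (G.Adj z) := by
      refine (Finset.eq_of_subset_of_card_le h1 ?_).ge
      rw [← ncard_commonNeighbors, hG.of_adj z y hyz.symm, Finset.card_erase_of_mem (by simpa),
        card_neighborFinset_eq_degree, hG.regular y]
      omega
    have h3 := h2 (show x ∈ _ by simp [hxz, hxy.symm])
    exact ((Finset.mem_filter.1 h3).2).symm
  ext x y
  rw [top_adj]
  refine ⟨fun h => h.ne, fun hne => ?_⟩
  have := hconn.mem_of_adj_closed (P := {z | x = z ∨ G.Adj x z}) (u := x) (Or.inl rfl) ?_ y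
  · exact this.resolve_left hne
  · rintro z (rfl | hz) w hw
    · exact Or.inr hw
    · by_cases hxw : x = w
      · exact Or.inl hxw
      · exact Or.inr (htrans x z w hz hw hxw)

/-- If `z ∈ S` lies on two edges of a cut of `d` edges while every vertex outside `S` lies on at most
one, then the `d` boundary vertices outside `S` are all the neighbours of `z`, and `z` accounts for
the whole cut. -/
theorem IsAmplyRegularWith.eq_singleton_of_two_le (hG : G.IsAmplyRegularWith d α β)
    (hconn : G.Connected) (hβ : 1 < β)
    (hD : G.IsOuterBoundary S D) (hsum : ∑ y ∈ D, (G.neighborsIn S y).card = d)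
    (hD' : G.IsOuterBoundary Sᶜ D') (hsum' : ∑ x ∈ D', (G.neighborsIn Sᶜ x).card ≤ d)
    (hone : ∀ y ∈ D, (G.neighborsIn S y).card = 1)
    {z : V} (hz : z ∈ D') (hz2 : 2 ≤ (G.neighborsIn Sᶜ z).card) : S = {z} := by
  classical
  have hzS : z ∈ S := by simpa using ((hD' z).1 hz).1
  have hadj := (hG.boundary_of_two_le hβ hD' hsum' hz hz2).2
  have hDz : ∀ y ∈ D, G.Adj z y := by
    intro y hy
    obtain ⟨hyS, x, hx, hxy⟩ := (hD y).1 hy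
    exact (hadj y hyS x (by simpa using hx) hxy.symm).symm
  have hcard : D.card = d := by
    rw [← hsum, Finset.card_eq_sum_ones]
    exact Finset.sum_congr rfl fun y hy => (hone y hy).symm
  have hnbr : D = G.neighborFinset z := by
    refine Finset.eq_of_subset_of_card_le (fun y hy => by simpa using hDz y hy) ?_
    rw [card_neighborFinset_eq_degree, hG.regular z, hcard]
  have hcl : ∀ v, v ∈ {v | v ∉ S ∨ v = z} := by
    refine hconn.mem_of_adj_closed (u := z) (Or.inr rfl) ?_
    rintro v (hv | rfl) w hvw
    · by_cases hw : w ∈ S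
      · right
        have hvD : v ∈ D := (hD v).2 ⟨hv, w, hw, hvw.symm⟩
        exact Finset.card_le_one.1 (hone v hvD).le w (by simp [hw, hvw]) z
          (by simp [hzS, (hDz v hvD).symm])
      · exact Or.inl hw
    · have : w ∈ D := by rw [hnbr]; simpa using hvw
      exact Or.inl ((hD w).1 this).1
  ext v
  rw [Set.mem_singleton_iff]
  exact ⟨fun hv => (hcl v).resolve_left (not_not.2 hv), fun h => h ▸ hzS⟩

/-- If the `d` edges of a cut form a matching, the boundary on either side is a clique of size `d`,
and its vertices have no neighbours beyond the two boundaries. -/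
theorem IsAmplyRegularWith.adj_of_matching_cut (hG : G.IsAmplyRegularWith d α β) (hβ : 1 < β)
    (hD : G.IsOuterBoundary S D) (hsum : ∑ y ∈ D, (G.neighborsIn S y).card = d)
    (hD' : G.IsOuterBoundary Sᶜ D')
    (hone : ∀ y ∈ D, (G.neighborsIn S y).card = 1)
    (hone' : ∀ x ∈ D', (G.neighborsIn Sᶜ x).card = 1) :
    (∀ y ∈ D, ∀ z ∈ D, y ≠ z → G.Adj y z) ∧
      ∀ y ∈ D, ∀ z, G.Adj y z → z ∈ D ∨ z ∈ D' := by
  classical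
  have hclique : ∀ y ∈ D, ∀ z ∈ D, y ≠ z → G.Adj y z := by
    intro y hy z hz hyz
    obtain ⟨hyS, x, hx, hxy⟩ := (hD y).1 hy
    refine ((hG.sum_eq_and_of_cut_edge hβ hD hsum.le hx hyS hxy).2 z hz hyz.symm).2.2 fun hxz => hyz ?_
    have hxD : x ∈ D' := (hD' x).2 ⟨by simpa using hx, y, hyS, hxy.symm⟩
    exact Finset.card_le_one.1 (hone' x hxD).le y (by simp [hxy, hyS]) z
      (by simp [hxz, ((hD z).1 hz).1])
  refine ⟨hclique, fun y hy z hyz => ?_⟩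
  obtain ⟨hyS, x, hx, hxy⟩ := (hD y).1 hy
  have hxD : x ∉ D.erase y := fun h => ((hD x).1 (Finset.mem_of_mem_erase h)).1 hx
  have hcard : D.card = d := by
    rw [← hsum, Finset.card_eq_sum_ones]
    exact Finset.sum_congr rfl fun y hy => (hone y hy).symm
  have hsub : insert x (D.erase y) ⊆ G.neighborFinset y := by
    intro w hw
    rw [mem_neighborFinset]
    rcases Finset.mem_insert.1 hw with rfl | hw
    · exact hxy.symm
    · exact hclique y hy w (Finset.mem_of_mem_erase hw) (Finset.ne_of_mem_erase hw).symm
  have heq := Finset.eq_of_subset_of_card_le hsub (by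
    rw [card_neighborFinset_eq_degree, hG.regular y, Finset.card_insert_of_notMem hxD,
      Finset.card_erase_add_one hy, hcard])
  have hz : z ∈ insert x (D.erase y) := by rw [heq]; simpa using hyz
  rcases Finset.mem_insert.1 hz with rfl | hz
  · exact Or.inr ((hD' z).2 ⟨by simpa using hx, y, hyS, hxy.symm⟩)
  · exact Or.inl (Finset.mem_of_mem_erase hz)

/-- A nonempty cut of at most `d` edges isolates a single vertex, unless `G` is a quadrangle. -/
theorem IsAmplyRegularWith.cut_trivial (hG : G.IsAmplyRegularWith d α β)
    (hconn : G.Connected) (hβ : 1 < β)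
    (hD : G.IsOuterBoundary S D) (hsum : ∑ y ∈ D, (G.neighborsIn S y).card ≤ d)
    (hD' : G.IsOuterBoundary Sᶜ D') (hsum' : ∑ x ∈ D', (G.neighborsIn Sᶜ x).card ≤ d)
    {s t : V} (hs : s ∈ S) (ht : t ∉ S) (hst : G.Adj s t) :
    (∃ v, S = {v}) ∨ (∃ v, Sᶜ = {v}) ∨ Nonempty (G ≃g cycleGraph 4) := by
  classical
  have hsumD := (hG.sum_eq_and_of_cut_edge hβ hD hsum hs ht hst).1
  have hsumD' := (hG.sum_eq_and_of_cut_edge hβ hD' hsum' (S := Sᶜ) ht (by simpa using hs) hst.symm).1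
  have htD : t ∈ D := (hD t).2 ⟨ht, s, hs, hst⟩
  have hsD' : s ∈ D' := (hD' s).2 ⟨by simpa using hs, t, ht, hst.symm⟩
  have hDD : G.IsOuterBoundary Sᶜᶜ D := by rwa [compl_compl]
  by_cases h : ∃ y ∈ D, 2 ≤ (G.neighborsIn S y).card
  · obtain ⟨y, hy, hy2⟩ := h
    by_cases h' : ∃ x ∈ D', 2 ≤ (G.neighborsIn Sᶜ x).card
    · -- The vertices `x` and `y` are the centres of a double star containing all cut edges, so
      -- they share `d - 1` neighbours.
      exfalso
      obtain ⟨x, hx, hx2⟩ := h'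
      obtain ⟨hc, ha⟩ := hG.boundary_of_two_le hβ hD hsum hy hy2
      obtain ⟨hc', ha'⟩ := hG.boundary_of_two_le hβ hD' hsum' hx hx2
      have hDx : ∀ w ∈ D, G.Adj w x := by
        intro w hw
        obtain ⟨hwS, v, hv, hvw⟩ := (hD w).1 hw
        exact ha' w hwS v (by simpa using hv) hvw.symm
      have hDy : ∀ w ∈ D', G.Adj w y := by
        intro w hw
        obtain ⟨hwS, v, hv, hvw⟩ := (hD' w).1 hw
        exact ha w (by simpa using hwS) v hv hvw.symm
      have hDS : ∀ w ∈ D', w ∈ S := fun w hw => by simpa using ((hD' w).1 hw).1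
      have h1 : (G.neighborsIn S y).card = D'.card := by
        congr 1
        ext w
        rw [mem_neighborsIn]
        refine ⟨fun hw => (hD' w).2 ⟨by simpa using hw.2, y, ((hD y).1 hy).1, hw.1⟩,
          fun hw => ⟨(hDy w hw).symm, hDS w hw⟩⟩
      have h2 : ∑ w ∈ D.erase y, (G.neighborsIn S w).card = (D.erase y).card := by
        rw [Finset.card_eq_sum_ones]
        exact Finset.sum_congr rfl fun w hw =>
          (hc w (Finset.mem_of_mem_erase hw) (Finset.ne_of_mem_erase hw)).2
      have h3 : D'.card + (D.erase y).card = d := by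
        rw [← h1, ← h2, Finset.add_sum_erase _ (fun w => (G.neighborsIn S w).card) hy, hsumD]
      have h4 : (D'.erase x).card + (D.erase y).card ≤ α := by
        rw [← hG.of_adj x y (hDy x hx), ncard_commonNeighbors, ← Finset.card_union_of_disjoint]
        · refine Finset.card_le_card fun w hw => ?_
          simp only [Finset.mem_filter, mem_neighborFinset]
          rcases Finset.mem_union.1 hw with hw | hw
          · obtain ⟨hwx, hw⟩ := Finset.mem_erase.1 hw
            exact ⟨(hDy w hw).symm, (hc' w hw hwx).1.symm⟩
          · obtain ⟨hwy, hw⟩ := Finset.mem_erase.1 hw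
            exact ⟨(hc w hw hwy).1.symm, (hDx w hw).symm⟩
        · exact Finset.disjoint_left.2 fun w hw hw' =>
            ((hD w).1 (Finset.mem_of_mem_erase hw')).1 (hDS w (Finset.mem_of_mem_erase hw))
      have h5 := Finset.card_erase_add_one hx
      have h6 := hG.add_one_lt_degree hconn
      omega
    · refine Or.inr (Or.inl ⟨y, ?_⟩)
      refine hG.eq_singleton_of_two_le hconn hβ hD' hsumD' hDD ?_ ?_ hy ?_
      · simpa using hsum
      · intro x hx
        have h1 := hD'.card_neighborsIn_pos hx
        by_contra h2
        exact h' ⟨x, hx, by omega⟩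
      · simpa using hy2
  · have hone : ∀ y ∈ D, (G.neighborsIn S y).card = 1 := by
      intro y hy
      have h1 := hD.card_neighborsIn_pos hy
      by_contra h2
      exact h ⟨y, hy, by omega⟩
    by_cases h' : ∃ x ∈ D', 2 ≤ (G.neighborsIn Sᶜ x).card
    · obtain ⟨x, hx, hx2⟩ := h'
      exact Or.inl ⟨x, hG.eq_singleton_of_two_le hconn hβ hD hsumD hD' hsum' hone hx hx2⟩
    have hone' : ∀ x ∈ D', (G.neighborsIn Sᶜ x).card = 1 := by
      intro x hx
      have h1 := hD'.card_neighborsIn_pos hx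
      by_contra h2
      exact h' ⟨x, hx, by omega⟩
    right
    have hcard : D.card = d := by
      rw [← hsumD, Finset.card_eq_sum_ones]
      exact Finset.sum_congr rfl fun y hy => (hone y hy).symm
    have hcard' : D'.card = d := by
      rw [← hsumD', Finset.card_eq_sum_ones]
      exact Finset.sum_congr rfl fun y hy => (hone' y hy).symm
    obtain ⟨hq, hcl⟩ := hG.adj_of_matching_cut hβ hD hsumD hD' hone hone'
    obtain ⟨hq', hcl'⟩ := hG.adj_of_matching_cut hβ hD' hsumD' hDD hone' (by simpa using hone)
    have huniv : ∀ v, v ∈ {v | v ∈ D ∨ v ∈ D'} := by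
      refine hconn.mem_of_adj_closed (u := t) (Or.inl htD) ?_
      rintro v (hv | hv) w hw
      · exact hcl v hv w hw
      · exact (hcl' v hv w hw).symm
    have huniq : ∀ x ∈ S, ∀ y, y ∉ S → ∀ z, z ∉ S → G.Adj x y → G.Adj x z → y = z := by
      intro x hx y hy z hz hxy hxz
      have hxD : x ∈ D' := (hD' x).2 ⟨by simpa using hx, y, hy, hxy.symm⟩
      exact Finset.card_le_one.1 (hone' x hxD).le y (by simp [hxy, hy]) z (by simp [hxz, hz])
    have huniq' : ∀ x ∈ S, ∀ w ∈ S, ∀ y, y ∉ S → G.Adj x y → G.Adj w y → x = w := by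
      intro x hx w hw y hy hxy hwy
      have hyD : y ∈ D := (hD y).2 ⟨hy, x, hx, hxy⟩
      exact Finset.card_le_one.1 (hone y hyD).le x (by simp [hxy.symm, hx]) w
        (by simp [hwy.symm, hw])
    -- The endpoints of an edge of the matching have no common neighbour.
    have hα : α = 0 := by
      rw [← hG.of_adj s t hst, ncard_commonNeighbors, Finset.card_eq_zero,
        Finset.filter_eq_empty_iff]
      intro w hw hsw
      rw [mem_neighborFinset] at hw
      by_cases hwS : w ∈ S
      · exact hsw.ne (huniq' s hs w hwS t ht hst hw.symm)
      · exact hw.ne (huniq s hs t ht w hwS hst hsw)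
    have hnotri : ∀ x y z, G.Adj x y → G.Adj x z → ¬ G.Adj y z := by
      intro x y z hxy hxz hyz
      have h1 := hG.of_adj x y hxy
      rw [hα, ncard_commonNeighbors, Finset.card_eq_zero, Finset.filter_eq_empty_iff] at h1
      exact h1 (by simpa using hyz) hxz
    by_cases hD1 : ∀ y ∈ D, y = t
    · refine Or.inl ⟨t, ?_⟩
      ext v
      rw [Set.mem_compl_iff, Set.mem_singleton_iff]
      refine ⟨fun hv => ?_, fun h => h ▸ ht⟩
      rcases huniv v with h1 | h1
      · exact hD1 v h1
      · exact absurd (by simpa using ((hD' v).1 h1).1) hv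
    · push Not at hD1
      obtain ⟨y, hyD, hyt⟩ := hD1
      obtain ⟨hyS, x, hx, hxy⟩ := (hD y).1 hyD
      have hxD' : x ∈ D' := (hD' x).2 ⟨by simpa using hx, y, hyS, hxy.symm⟩
      have hxs : x ≠ s := fun h => hyt (huniq x hx y hyS t ht hxy (h ▸ hst))
      refine Or.inr (nonempty_iso_cycleGraph_four (hq t htD y hyD hyt.symm) hxy.symm
        (hq' x hxD' s hsD' hxs) hst ?_ ?_ ?_ ?_ ?_)
      · exact fun h => hyt (huniq x hx y hyS t ht hxy h.symm)
      · exact fun h => hyt (huniq s hs y hyS t ht h.symm hst)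
      · exact fun h => ht (h ▸ hx)
      · exact fun h => hyS (h ▸ hs)
      · intro v
        rcases huniv v with hv | hv
        · by_cases hvt : v = t
          · exact Or.inl hvt
          · by_cases hvy : v = y
            · exact Or.inr (Or.inl hvy)
            · exact absurd (hq t htD y hyD hyt.symm) (hnotri v t y (hq v hv t htD hvt)
                (hq v hv y hyD hvy))
        · by_cases hvs : v = s
          · exact Or.inr (Or.inr (Or.inr hvs))
          · by_cases hvx : v = x
            · exact Or.inr (Or.inr (Or.inl hvx))
            · exact absurd (hq' s hsD' x hxD' hxs.symm) (hnotri v s x (hq' v hv s hsD' hvs)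
                (hq' v hv x hxD' hvx))

theorem IsAmplyRegularWith.eq_incidenceSet (hG : G.IsAmplyRegularWith d α β)
    {F : Set (Sym2 V)} (hF : F.encard = d) {v : V} (hv : ∀ y, G.Adj v y → s(v, y) ∈ F) :
    F = G.incidenceSet v := by
  classical
  have hfin : F.Finite := Set.finite_of_encard_eq_coe hF
  refine (hfin.eq_of_subset_of_encard_le' ?_ ?_).symm
  · intro e he
    induction e with
    | _ a b =>
      rw [mk'_mem_incidenceSet_iff] at he
      rcases he with ⟨hab, rfl | rfl⟩
      · exact hv b hab
      · rw [Sym2.eq_swap]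
        exact hv a hab.symm
  · rw [hF, ← coe_incidenceFinset, Set.encard_coe_eq_coe_finsetCard,
      card_incidenceFinset_eq_degree, hG.regular v]

end SimpleGraph

open SimpleGraph in
theorem theorem1p4 {V : Type*} (G : SimpleGraph V) [G.LocallyFinite] (d α β : ℕ)
    (hconn : G.Connected) (hG : G.IsAmplyRegularWith d α β) (hβ : 1 < β) :
    G.IsEdgeConnected d ∧
      (¬ Nonempty (G ≃g SimpleGraph.cycleGraph 4) →
        ∀ F : Set (Sym2 V), F ⊆ G.edgeSet → F.encard = d →
          (¬ (G.deleteEdges F).Connected ↔ ∃ v : V, F = G.incidenceSet v)) := by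
  constructor
  · intro u v F hF
    by_contra h
    obtain ⟨S, hS, s, hs, t, ht, hst⟩ := hconn.exists_cut h
    have hfin : F.Finite := Set.finite_of_encard_le_coe hF.le
    rw [← hfin.cast_ncard_eq, Nat.cast_lt] at hF
    obtain ⟨D, hD, hsum⟩ := exists_isOuterBoundary hfin hS
    have := (hG.sum_eq_and_of_cut_edge hβ hD (hsum.trans hF.le) hs ht hst).1
    omega
  · intro hC4 F hFG hF
    constructor
    · intro h
      have hfin : F.Finite := Set.finite_of_encard_eq_coe hF
      have hcard : F.ncard = d := by
        rw [← hfin.cast_ncard_eq, Nat.cast_inj] at hF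
        exact hF
      have hne : Nonempty V := hconn.nonempty
      rw [connected_iff, not_and_or, or_iff_left (not_not.2 hne)] at h
      unfold Preconnected at h
      push Not at h
      obtain ⟨u, v, huv⟩ := h
      obtain ⟨S, hS, s, hs, t, ht, hst⟩ := hconn.exists_cut huv
      have hS' : ∀ x ∈ Sᶜ, ∀ y, y ∉ Sᶜ → G.Adj x y → s(x, y) ∈ F := by
        intro x hx y hy hxy
        rw [Sym2.eq_swap]
        exact hS y (by simpa using hy) x hx hxy.symm
      obtain ⟨D, hD, hsum⟩ := exists_isOuterBoundary hfin hS
      obtain ⟨D', hD', hsum'⟩ := exists_isOuterBoundary hfin hS'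
      rw [hcard] at hsum hsum'
      rcases hG.cut_trivial hconn hβ hD hsum hD' hsum' hs ht hst with ⟨v, rfl⟩ | ⟨v, hv⟩ | h4
      · exact ⟨v, hG.eq_incidenceSet hF fun y hy => hS v rfl y hy.ne' hy⟩
      · rw [hv] at hS'
        exact ⟨v, hG.eq_incidenceSet hF fun y hy => hS' v rfl y hy.ne' hy⟩
      · exact absurd h4 hC4
    · rintro ⟨v, rfl⟩ hcon
      obtain ⟨a, b, hab⟩ := ne_bot_iff_exists_adj.1 hG.not_empty
      obtain ⟨w, hw⟩ : ∃ w, w ≠ v := by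
        by_cases h : a = v
        · exact ⟨b, fun hb => hab.ne (h.trans hb.symm)⟩
        · exact ⟨a, h⟩
      have := hcon.mem_of_adj_closed (P := {v}) (u := v) rfl (by
        rintro x rfl y hxy
        rw [deleteEdges_adj, mk'_mem_incidenceSet_left_iff] at hxy
        exact absurd hxy.1 hxy.2) w
      exact hw this
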